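/- Let $K,N,d$ be natural numbers with $N\ge 1$, and let $V$ be an $N$-dimensional complex vector space. Write $G(d,N)$ for the Grassmannian of $d$-dimensional subspaces of $V$. A collection $(V_1,\dots,V_K)$ of subspaces of $V$ is called a feasible strategy (for the tuple $(K,N,d)$) if (i) $\dim V_i=d$ for all $i$; (ii) $V_i=\bigoplus_{j\ne i}V_i\cap V_j$ for all $i$; and (iii) $V=\bigoplus_{1\le i<j\le K}V_i\cap V_j$. The tuple $(K,N,d)$ is called feasible if a feasible strategy exists. The feasible variety is $$\mathcal Z=\Big\{(V_1,\dots,V_K)\in\prod_{i=1}^K G(d,N)\ :\ (V_1,\dots,V_K)\text{ is a feasible strategy}\Big\}.$$ Give $\prod_{i=1}^K G(d,N)$ the Zariski topology, that is, the topology it has as a subvariety of $\prod_{i=1}^K\mathbb P(\bigwedge^d V)$ through the Plücker embedding of each factor; the closed subsets of this product of projective spaces are the common zero sets of families of multihomogeneous polynomials. Theorem. Suppose that $(K,N,d)$ is a feasible tuple with $N\ge1$. Then $\mathcal Z$ is a dense, Zariski open subset of $\prod_{i=1}^K G(d,N)$ if and only if $(K,N,d)$ is of the form $(2,N,N)$ or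 $(3,N,2N/3)$. -/

import Mathlib

open scoped LinearAlgebra.Projectivization Topology

namespace RelayFeasibility

section Strategies

variable {V : Type*} [AddCommGroup V] [Module ℂ V]

/-- The subspace `U` is the internal direct sum of the family of subspaces `A`. -/
def IsDirectSumOf {ι : Type*} (U : Submodule ℂ V) (A : ι → Submodule ℂ V) : Prop :=
  iSupIndep A ∧ U = ⨆ i, A i

/-- Subspaces `W 1, …, W K` of `V` form a feasible strategy with dimensions `d 1, …, d K`:
(i) `dim (W i) = d i`;
(ii) every `W i` is the direct sum of the `W i ∩ W j`, `j ≠ i`;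
(iii) `V` is the direct sum of the `W i ∩ W j`, `i < j`. -/
structure IsFeasibleStrategy {K : ℕ} (d : Fin K → ℕ) (W : Fin K → Submodule ℂ V) : Prop where
  finrank_eq : ∀ i, Module.finrank ℂ (W i) = d i
  decomp : ∀ i, IsDirectSumOf (W i) (fun j : {j : Fin K // j ≠ i} => W i ⊓ W j)
  decomp_top : IsDirectSumOf (⊤ : Submodule ℂ V)
    (fun p : {p : Fin K × Fin K // p.1 < p.2} => W p.1.1 ⊓ W p.1.2)

end Strategies

/-- The tuple `(K, N, d 1, …, d K)` is feasible: the `N`-dimensional complex vector space (unique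
up to isomorphism) has a feasible strategy with these dimensions. -/
def IsFeasibleTuple (K N : ℕ) (d : Fin K → ℕ) : Prop :=
  ∃ W : Fin K → Submodule ℂ (Fin N → ℂ), IsFeasibleStrategy d W

/-! ### The Zariski topology of a product of projective spaces -/

section MultiProjective

variable {K : ℕ} {E : Fin K → Type*} [∀ i, AddCommGroup (E i)] [∀ i, Module ℂ (E i)]

/-- Formal polynomials in the linear forms on the vector spaces `E 1, …, E K`. -/
abbrev FormPoly (E : Fin K → Type*) [∀ i, AddCommGroup (E i)] [∀ i, Module ℂ (E i)] : Type _ :=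
  MvPolynomial (Σ i, Module.Dual ℂ (E i)) ℂ

/-- The polynomial function on `E 1 × ⋯ × E K` given by a polynomial in linear forms. -/
noncomputable def FormPoly.evalAt (f : FormPoly E) (v : ∀ i, E i) : ℂ :=
  MvPolynomial.eval (fun x : Σ i, Module.Dual ℂ (E i) => x.2 (v x.1)) f

/-- `f` is multihomogeneous of multidegree `m`: in each monomial the total degree in the linear
forms on `E i` is `m i`. -/
def FormPoly.IsMultihomogeneous (f : FormPoly E) (m : Fin K → ℕ) : Prop :=
  MvPolynomial.IsWeightedHomogeneous
    (fun x : Σ i, Module.Dual ℂ (E i) => (Pi.single x.1 1 : Fin K → ℕ)) f m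

/-- Rescaling the homogeneous coordinates rescales the value of a multihomogeneous polynomial. -/
theorem FormPoly.IsMultihomogeneous.evalAt_smul {f : FormPoly E} {m : Fin K → ℕ}
    (hf : f.IsMultihomogeneous m) (c : Fin K → ℂ) (v : ∀ i, E i) :
    f.evalAt (fun i => c i • v i) = (∏ i, c i ^ m i) * f.evalAt v := by
  unfold FormPoly.evalAt
  rw [MvPolynomial.eval_eq, MvPolynomial.eval_eq, Finset.mul_sum]
  refine Finset.sum_congr rfl fun s hs => ?_
  have hw : Finsupp.weight (fun x : Σ i, Module.Dual ℂ (E i) => (Pi.single x.1 1 : Fin K → ℕ)) s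
      = m := hf (MvPolynomial.mem_support_iff.mp hs)
  have key : ∏ i, c i ^ m i = ∏ x ∈ s.support, c x.1 ^ s x := by
    rw [← hw, Finsupp.weight_apply, Finsupp.sum]
    simp only [Finset.sum_apply, Pi.smul_apply, smul_eq_mul, ← Finset.prod_pow_eq_pow_sum]
    rw [Finset.prod_comm]
    refine Finset.prod_congr rfl fun x _ => ?_
    rw [Finset.prod_eq_single x.1]
    · simp
    · intro i _ hi
      simp [Pi.single_eq_of_ne hi]
    · simp
  rw [key]
  simp only [map_smul, smul_eq_mul, mul_pow, Finset.prod_mul_distrib]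
  ring

/-- The common zero locus in `ℙ(E 1) × ⋯ × ℙ(E K)` of a set of multihomogeneous polynomials. -/
def zeroLocus (S : Set (FormPoly E)) : Set (∀ i, ℙ ℂ (E i)) :=
  {p | ∀ f ∈ S, f.evalAt (fun i => (p i).rep) = 0}

/-- Vanishing of a multihomogeneous polynomial does not depend on the representatives. -/
theorem evalAt_rep_eq_zero_iff {f : FormPoly E} {m : Fin K → ℕ} (hf : f.IsMultihomogeneous m)
    (v : ∀ i, E i) (hv : ∀ i, v i ≠ 0) :
    f.evalAt (fun i => (Projectivization.mk ℂ (v i) (hv i)).rep) = 0 ↔ f.evalAt v = 0 := by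
  choose a ha using fun i => Projectivization.exists_smul_eq_mk_rep ℂ (v i) (hv i)
  have h : (fun i => (Projectivization.mk ℂ (v i) (hv i)).rep)
      = fun i => ((a i : ℂˣ) : ℂ) • v i := by
    funext i
    rw [← ha i, Units.smul_def]
  rw [h, hf.evalAt_smul, mul_eq_zero, or_iff_right]
  exact Finset.prod_ne_zero_iff.mpr fun i _ => pow_ne_zero _ (a i).ne_zero

/-- The Zariski topology on `ℙ(E 1) × ⋯ × ℙ(E K)`: the closed sets are the common zero loci of
sets of multihomogeneous polynomials. -/
@[reducible] def multiProjZariski (E : Fin K → Type*) [∀ i, AddCommGroup (E i)] [∀ i, Module ℂ (E i)] :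
    TopologicalSpace (∀ i, ℙ ℂ (E i)) :=
  TopologicalSpace.ofClosed
    {Z | ∃ S : Set (FormPoly E), (∀ f ∈ S, ∃ m, f.IsMultihomogeneous m) ∧ Z = zeroLocus S}
    (by
      refine ⟨{1}, ?_, ?_⟩
      · rintro f rfl
        exact ⟨0, MvPolynomial.isWeightedHomogeneous_one _ _⟩
      · ext p
        simp [zeroLocus, FormPoly.evalAt])
    (by
      intro A hA
      refine ⟨{f | (∃ m, f.IsMultihomogeneous m) ∧
        ∃ Z ∈ A, ∀ p ∈ Z, f.evalAt (fun i => (p i).rep) = 0}, fun f hf => hf.1, ?_⟩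
      ext p
      constructor
      · rintro hp f ⟨-, Z, hZ, hf⟩
        exact hf p (hp Z hZ)
      · intro hp Z hZ
        obtain ⟨S, hS, rfl⟩ := hA hZ
        exact fun f hf => hp f ⟨hS f hf, _, hZ, fun q hq => hq f hf⟩)
    (by
      rintro _ ⟨S, hS, rfl⟩ _ ⟨T, hT, rfl⟩
      refine ⟨{h | ∃ f ∈ S, ∃ g ∈ T, h = f * g}, ?_, ?_⟩
      · rintro _ ⟨f, hf, g, hg, rfl⟩
        obtain ⟨m, hm⟩ := hS f hf
        obtain ⟨n, hn⟩ := hT g hg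
        exact ⟨m + n, MvPolynomial.IsWeightedHomogeneous.mul hm hn⟩
      · ext p
        constructor
        · rintro (hp | hp) _ ⟨f, hf, g, hg, rfl⟩
          · have := hp f hf
            simp only [FormPoly.evalAt, map_mul] at this ⊢
            rw [this, zero_mul]
          · have := hp g hg
            simp only [FormPoly.evalAt, map_mul] at this ⊢
            rw [this, mul_zero]
        · intro hp
          by_contra hcon
          rw [Set.mem_union, not_or] at hcon
          simp only [zeroLocus, Set.mem_ofPred_eq, not_forall] at hcon
          obtain ⟨⟨f, hf, hf0⟩, g, hg, hg0⟩ := hcon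
          have := hp (f * g) ⟨f, hf, g, hg, rfl⟩
          simp only [FormPoly.evalAt, map_mul, mul_eq_zero] at this hf0 hg0
          exact this.elim hf0 hg0)

end MultiProjective

/-! ### Grassmannians -/

section Grassmannians

variable (V : Type*) [AddCommGroup V] [Module ℂ V]

/-- The Grassmannian of `d`-dimensional subspaces of `V`. -/
def Gr (d : ℕ) : Type _ :=
  {W : Submodule ℂ V // Module.finrank ℂ W = d}

variable [FiniteDimensional ℂ V]

theorem finrank_range_exteriorPower_map {d : ℕ} (W : Gr V d) :
    Module.finrank ℂ (LinearMap.range (exteriorPower.map d W.1.subtype)) = 1 := by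
  rw [LinearMap.finrank_range_of_inj
    (exteriorPower.map_injective_field (f := W.1.subtype) W.1.injective_subtype),
    exteriorPower.finrank_eq, W.2, Nat.choose_self]

/-- The Plücker embedding `G(d, V) → ℙ(⋀ᵈ V)`, sending `W` to the line `⋀ᵈ W ⊆ ⋀ᵈ V`. -/
noncomputable def plucker {d : ℕ} (W : Gr V d) : ℙ ℂ (⋀[ℂ]^d V) :=
  Projectivization.mk'' (LinearMap.range (exteriorPower.map d W.1.subtype))
    (finrank_range_exteriorPower_map V W)

/-- The Plücker embedding sends the span of independent `v 1, …, v d` to the line through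
`v 1 ∧ ⋯ ∧ v d`. -/
theorem plucker_submodule {d : ℕ} (W : Gr V d) (b : Module.Basis (Fin d) ℂ W.1) :
    (plucker V W).submodule = Submodule.span ℂ {exteriorPower.ιMulti ℂ d fun i => (b i : V)} := by
  have h1 : (exteriorPower.ιMulti ℂ d fun i => (b i : V))
      = exteriorPower.map d W.1.subtype (exteriorPower.ιMulti ℂ d b) := by
    rw [exteriorPower.map_apply_ιMulti]
    rfl
  have hspan : Submodule.span ℂ {exteriorPower.ιMulti ℂ d b} = ⊤ := by
    have h2 := exteriorPower.ιMulti_family_span_of_span (n := d) ℂ b.span_eq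
    rw [eq_top_iff, ← h2, Submodule.span_le]
    rintro _ ⟨s, rfl⟩
    have hs : s = ⟨Finset.univ, by simp⟩ := by
      apply Subtype.ext
      exact Finset.eq_univ_of_card _ (by simp)
    apply Submodule.subset_span
    subst hs
    rw [Set.mem_singleton_iff]
    unfold exteriorPower.ιMulti_family
    congr 1
    funext i
    simp only [Function.comp_apply]
    congr 1
    have hiso : ∀ g : Fin d ↪o Fin d, g i = i := fun g =>
      congrArg (fun e : Fin d ≃o Fin d => e i) (Subsingleton.elim
        (RelIso.ofSurjective g (Finite.injective_iff_surjective.mp g.injective))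
        (OrderIso.refl (Fin d)))
    exact hiso _
  rw [plucker, Projectivization.submodule_mk'', h1, ← Set.image_singleton, ← Submodule.map_span,
    hspan, Submodule.map_top]

variable {K : ℕ} (d : Fin K → ℕ)

/-- The Zariski topology on `G(d 1, V) × ⋯ × G(d K, V)`, as a subvariety of
`ℙ(⋀^{d 1} V) × ⋯ × ℙ(⋀^{d K} V)` through the Plücker embeddings. -/
@[reducible] noncomputable def grassmannianZariski : TopologicalSpace (∀ i, Gr V (d i)) :=
  TopologicalSpace.induced (fun W i => plucker V (W i))
    (multiProjZariski fun i => ⋀[ℂ]^(d i) V)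

/-- The feasible variety: the points of `G(d 1, V) × ⋯ × G(d K, V)` that are feasible
strategies. -/
def feasibleVariety : Set (∀ i, Gr V (d i)) :=
  {W | IsFeasibleStrategy d fun i => (W i).1}

end Grassmannians

end RelayFeasibility

/-!
Counting dimensions in the decompositions of the `W i` and of `V`, every `W i ∩ W j` occurs twice
among the former and once in the latter, so `K d = 2 N`. Hence `K ≥ 2`, and it remains to decide
for which `K` the feasible variety is open and dense.

* For `K = 2` one has `d = N`, and the product of Grassmannians is a single, feasible point.
* For `K = 3` three subspaces of dimension `d = 2N/3` are a feasible strategy exactly when they have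
  no common nonzero vector (`isFeasibleStrategy_three_iff`): the dimension formula bounds
  `dim (W i ∩ W j)` from below by `N/3`, while independence inside `W i` bounds it from above. This
  is an open condition (`isOpen_trivial_inter`): if `w i` are Plücker coordinates of `W i`, then
  `W i` is the kernel of `x ↦ x ∧ w i`, so the condition is that `x ↦ (x ∧ w i)ᵢ` is injective, and
  the maximal minors of this map are multihomogeneous in the `w i`.
  A nonempty open set is dense (`dense_of_isOpen_of_nonempty`), because two points of the product
  are joined by a rational curve: pencils between bases of the subspaces. On it a polynomial in the
  Plücker coordinates becomes a polynomial in one variable.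
* For `K ≥ 4` one has `2 d ≤ N`, so there are subspaces with `W i ∩ W j = 0` for a fixed `i` and all
  `j ≠ i`. By `isOpen_trivial_inter` they form an open set, and it contains no feasible
  strategy, since `W i` would have to be the sum of the `W i ∩ W j`
  (`not_dense_feasibleVariety`).
-/

namespace RelayFeasibility

/-! ### Dimensions in internal direct sums -/

section Dimension

variable {V : Type*} [AddCommGroup V] [Module ℂ V]

theorem finrank_eq_sum_of_isDirectSumOf [FiniteDimensional ℂ V] {ι : Type*} [Fintype ι]
    {U : Submodule ℂ V} {A : ι → Submodule ℂ V} (h : IsDirectSumOf U A) :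
    Module.finrank ℂ U = ∑ i, Module.finrank ℂ (A i) := by
  classical
  rw [h.2, ← DirectSum.range_coeLinearMap, ← Module.finrank_directSum ℂ (fun i => A i)]
  exact LinearMap.finrank_range_of_inj h.1.dfinsupp_lsum_injective

/-- A subspace spanned by subspaces whose dimensions add up to at most its own dimension is their
direct sum. -/
theorem isDirectSumOf_of_sum_finrank_le [FiniteDimensional ℂ V] {ι : Type*} [Fintype ι]
    {U : Submodule ℂ V} {A : ι → Submodule ℂ V} (hU : U = ⨆ i, A i)
    (hle : ∑ i, Module.finrank ℂ (A i) ≤ Module.finrank ℂ U) : IsDirectSumOf U A := by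
  classical
  refine ⟨iSupIndep_of_dfinsupp_lsum_injective _ ?_, hU⟩
  change Function.Injective (DirectSum.coeLinearMap A)
  rw [hU, ← DirectSum.range_coeLinearMap, ← Module.finrank_directSum ℂ (fun i => A i)] at hle
  have h1 := LinearMap.finrank_range_add_finrank_ker (DirectSum.coeLinearMap A)
  rw [← LinearMap.ker_eq_bot]
  apply Submodule.finrank_eq_zero.mp
  omega

/-- Every intersection `W i ⊓ W j` occurs in the decompositions of both `W i` and `W j`, so the
dimensions of the `W i` add up to twice the dimension of the ambient space. -/
theorem IsFeasibleStrategy.sum_eq_two_mul_finrank [FiniteDimensional ℂ V] {K : ℕ} {d : Fin K → ℕ}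
    {W : Fin K → Submodule ℂ V} (h : IsFeasibleStrategy d W) :
    ∑ i, d i = 2 * Module.finrank ℂ V := by
  set m : Fin K → Fin K → ℕ := fun i j => Module.finrank ℂ (W i ⊓ W j : Submodule ℂ V) with hm
  have hsymm : ∀ i j, m i j = m j i := fun i j => by
    simp only [hm]
    rw [inf_comm]
  have h1 : ∀ i, d i = ∑ j with j ≠ i, m i j := fun i => by
    rw [← h.finrank_eq i, finrank_eq_sum_of_isDirectSumOf (h.decomp i)]
    exact (Finset.sum_subtype _ (by simp) (fun j => m i j)).symm
  have h2 : Module.finrank ℂ V = ∑ p : Fin K × Fin K with p.1 < p.2, m p.1 p.2 := by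
    rw [← finrank_top ℂ V, finrank_eq_sum_of_isDirectSumOf h.decomp_top]
    exact (Finset.sum_subtype _ (by simp) (fun p : Fin K × Fin K => m p.1 p.2)).symm
  have h3 : ∑ i, ∑ j, (if i < j then m i j else 0) = Module.finrank ℂ V := by
    rw [h2, Finset.sum_filter, Fintype.sum_prod_type]
  have h4 : ∑ i, ∑ j, (if j < i then m i j else 0) = Module.finrank ℂ V := by
    rw [← h3, Finset.sum_comm]
    exact Finset.sum_congr rfl fun i _ => Finset.sum_congr rfl fun j _ => by
      split_ifs <;> simp [hsymm i j]
  rw [two_mul]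
  nth_rewrite 1 [← h3]
  rw [← h4, ← Finset.sum_add_distrib]
  refine Finset.sum_congr rfl fun i _ => ?_
  rw [h1, Finset.sum_filter, ← Finset.sum_add_distrib]
  refine Finset.sum_congr rfl fun j _ => ?_
  rcases lt_trichotomy i j with hij | rfl | hij
  · simp [hij, hij.ne', hij.not_gt]
  · simp
  · simp [hij, hij.ne, hij.not_gt]

end Dimension

/-! ### Plücker coordinates -/

section Plucker

variable {V : Type*} [AddCommGroup V] [Module ℂ V]

theorem ιMulti_ne_zero_of_linearIndependent {d : ℕ} {v : Fin d → V}
    (hv : LinearIndependent ℂ v) : exteriorPower.ιMulti ℂ d v ≠ 0 := by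
  have h := (exteriorPower.ιMulti_family_linearIndependent_field (n := d) hv).ne_zero
    ⟨Finset.univ, by simp⟩
  intro h0
  apply h
  rw [← h0]
  unfold exteriorPower.ιMulti_family
  congr 1
  funext i
  simp only [Function.comp_apply]
  congr 1
  have hiso : ∀ g : Fin d ↪o Fin d, g i = i := fun g =>
    congrArg (fun e : Fin d ≃o Fin d => e i) (Subsingleton.elim
      (RelIso.ofSurjective g (Finite.injective_iff_surjective.mp g.injective))
      (OrderIso.refl (Fin d)))
  exact hiso _

theorem linearIndependent_of_ιMulti_ne_zero {d : ℕ} {v : Fin d → V}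
    (hv : exteriorPower.ιMulti ℂ d v ≠ 0) : LinearIndependent ℂ v := by
  by_contra h
  exact hv ((exteriorPower.ιMulti ℂ d).map_linearDependent v h)

theorem mem_span_iff_ι_mul_ιMulti_eq_zero {d : ℕ} {v : Fin d → V}
    (hv : LinearIndependent ℂ v) (x : V) :
    x ∈ Submodule.span ℂ (Set.range v) ↔
      ExteriorAlgebra.ι ℂ x * ExteriorAlgebra.ιMulti ℂ d v = 0 := by
  have h : ExteriorAlgebra.ι ℂ x * ExteriorAlgebra.ιMulti ℂ d v
      = (exteriorPower.ιMulti ℂ (d + 1) (Fin.cons x v : Fin (d + 1) → V) :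
          ExteriorAlgebra ℂ V) := by
    rw [exteriorPower.ιMulti_apply_coe, ExteriorAlgebra.ιMulti_succ_apply]
    rfl
  rw [h, Submodule.coe_eq_zero]
  constructor
  · intro hx
    by_contra h0
    exact (linearIndependent_finCons.mp (linearIndependent_of_ιMulti_ne_zero h0)).2 hx
  · intro h0
    by_contra hx
    exact ιMulti_ne_zero_of_linearIndependent (linearIndependent_finCons.mpr ⟨hv, hx⟩) h0

variable [FiniteDimensional ℂ V]

theorem plucker_eq_mk {d : ℕ} (W : Gr V d) {v : Fin d → V} (hv : LinearIndependent ℂ v)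
    (hspan : Submodule.span ℂ (Set.range v) = W.1) :
    plucker V W = Projectivization.mk ℂ (exteriorPower.ιMulti ℂ d v)
      (ιMulti_ne_zero_of_linearIndependent hv) := by
  apply Projectivization.submodule_injective
  rw [plucker_submodule V W ((Module.Basis.span hv).map (LinearEquiv.ofEq _ _ hspan)),
    Projectivization.submodule_mk]
  simp only [Module.Basis.map_apply, LinearEquiv.coe_ofEq_apply, Module.Basis.span_apply]

theorem Gr.exists_spanning {d : ℕ} (W : Gr V d) :
    ∃ v : Fin d → V, LinearIndependent ℂ v ∧ Submodule.span ℂ (Set.range v) = W.1 := by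
  let b := Module.finBasisOfFinrankEq ℂ W.1 W.2
  refine ⟨fun i => (b i : V), b.linearIndependent.map' W.1.subtype (Submodule.ker_subtype _), ?_⟩
  have h := congrArg (Submodule.map W.1.subtype) b.span_eq
  rw [Submodule.map_span, ← Set.range_comp, Submodule.map_top, Submodule.range_subtype] at h
  exact h

/-- A subspace is recovered from its Plücker coordinates `w` as the kernel of `x ↦ x ∧ w`. -/
theorem mem_iff_ι_mul_plucker_rep_eq_zero {d : ℕ} (W : Gr V d) (x : V) :
    x ∈ W.1 ↔ ExteriorAlgebra.ι ℂ x * ((plucker V W).rep : ExteriorAlgebra ℂ V) = 0 := by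
  obtain ⟨v, hv, hspan⟩ := W.exists_spanning
  obtain ⟨a, ha⟩ := Projectivization.exists_smul_eq_mk_rep ℂ (exteriorPower.ιMulti ℂ d v)
    (ιMulti_ne_zero_of_linearIndependent hv)
  rw [plucker_eq_mk W hv hspan, ← ha, ← hspan, mem_span_iff_ι_mul_ιMulti_eq_zero hv,
    Units.smul_def, Submodule.coe_smul, mul_smul_comm, smul_eq_zero_iff_right a.ne_zero,
    exteriorPower.ιMulti_apply_coe]

end Plucker

/-! ### Open subsets of products of Grassmannians -/

section Zariski

variable {V : Type*} [AddCommGroup V] [Module ℂ V] [FiniteDimensional ℂ V]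
  {K : ℕ} {d : Fin K → ℕ}

/-- The value of a polynomial at a point of a product of Grassmannians, computed with chosen
homogeneous Plücker coordinates. For multihomogeneous polynomials its vanishing does not depend on
the choice. -/
noncomputable def pluckerEval (f : FormPoly fun i => ⋀[ℂ]^(d i) V) (W : ∀ i, Gr V (d i)) : ℂ :=
  f.evalAt fun i => (plucker V (W i)).rep

theorem isOpen_pluckerEval_ne_zero {f : FormPoly fun i => ⋀[ℂ]^(d i) V} {m : Fin K → ℕ}
    (hf : f.IsMultihomogeneous m) :
    IsOpen[grassmannianZariski V d] {W | pluckerEval f W ≠ 0} := by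
  refine (@isOpen_induced_iff _ _ (multiProjZariski _) _ _).mpr ⟨(zeroLocus {f})ᶜ, ?_, ?_⟩
  · refine ⟨{f}, ?_, compl_compl _⟩
    rintro _ rfl
    exact ⟨m, hf⟩
  · ext W
    simp [zeroLocus, pluckerEval]

/-- The nonvanishing loci of multihomogeneous polynomials form a basis of the topology. -/
theorem isOpen_iff_exists_pluckerEval_ne_zero {U : Set (∀ i, Gr V (d i))} :
    IsOpen[grassmannianZariski V d] U ↔ ∀ W ∈ U, ∃ f : FormPoly fun i => ⋀[ℂ]^(d i) V,
      (∃ m, f.IsMultihomogeneous m) ∧ pluckerEval f W ≠ 0 ∧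
        ∀ W', pluckerEval f W' ≠ 0 → W' ∈ U := by
  constructor
  · intro hU W hW
    obtain ⟨T, ⟨S, hS, hT⟩, rfl⟩ :=
      (@isOpen_induced_iff _ _ (multiProjZariski _) _ _).mp hU
    have key : ∀ W' : ∀ i, Gr V (d i), (fun i => plucker V (W' i)) ∈ T ↔
        ∃ f ∈ S, pluckerEval f W' ≠ 0 := fun W' => by
      rw [← not_iff_not, ← Set.mem_compl_iff, hT]
      simp [zeroLocus, pluckerEval]
    obtain ⟨f, hfS, hf⟩ := (key W).mp hW
    exact ⟨f, hS f hfS, hf, fun W' hW' => (key W').mpr ⟨f, hfS, hW'⟩⟩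
  · intro h
    refine (@isOpen_iff_forall_mem_open _ (grassmannianZariski V d) _).mpr fun W hW => ?_
    obtain ⟨f, ⟨m, hm⟩, hf, hU⟩ := h W hW
    exact ⟨_, hU, isOpen_pluckerEval_ne_zero hm, hf⟩

theorem pluckerEval_ne_zero_iff {f : FormPoly fun i => ⋀[ℂ]^(d i) V} {m : Fin K → ℕ}
    (hf : f.IsMultihomogeneous m) (W : ∀ i, Gr V (d i)) {v : ∀ i, Fin (d i) → V}
    (hv : ∀ i, LinearIndependent ℂ (v i))
    (hspan : ∀ i, Submodule.span ℂ (Set.range (v i)) = (W i).1) :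
    pluckerEval f W ≠ 0 ↔ f.evalAt (fun i => exteriorPower.ιMulti ℂ (d i) (v i)) ≠ 0 := by
  rw [not_iff_not, ← evalAt_rep_eq_zero_iff hf _
    fun i => ιMulti_ne_zero_of_linearIndependent (hv i), pluckerEval]
  simp only [fun i => plucker_eq_mk (W i) (hv i) (hspan i)]

/-- The linear form `w ↦ φ (x ∧ w)` on an exterior power. -/
noncomputable def wedgeForm (n : ℕ) (φ : Module.Dual ℂ (ExteriorAlgebra ℂ V)) (x : V) :
    Module.Dual ℂ (⋀[ℂ]^n V) :=
  φ ∘ₗ LinearMap.mulLeft ℂ (ExteriorAlgebra.ι ℂ x) ∘ₗ Submodule.subtype _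

/-- In the basis `e` of `V`, the minor of the linear map `x ↦ (x ∧ w i)ᵢ`, where `w i` are the
coordinates on the `i`-th factor, whose `k`-th row is the form `φ k` on the component `r k`. -/
noncomputable def wedgeMinor (d : Fin K → ℕ) {n : ℕ} (e : Module.Basis (Fin n) ℂ V)
    (r : Fin n → Fin K) (φ : Fin n → Module.Dual ℂ (ExteriorAlgebra ℂ V)) :
    FormPoly fun i => ⋀[ℂ]^(d i) V :=
  Matrix.det (Matrix.of fun k j =>
    (MvPolynomial.X ⟨r k, wedgeForm (d (r k)) (φ k) (e j)⟩ : FormPoly fun i => ⋀[ℂ]^(d i) V))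

omit [FiniteDimensional ℂ V] in
theorem isMultihomogeneous_wedgeMinor {n : ℕ} (e : Module.Basis (Fin n) ℂ V)
    (r : Fin n → Fin K) (φ : Fin n → Module.Dual ℂ (ExteriorAlgebra ℂ V)) :
    (wedgeMinor d e r φ).IsMultihomogeneous (∑ k, Pi.single (r k) 1) := by
  unfold wedgeMinor FormPoly.IsMultihomogeneous
  rw [← Matrix.det_transpose, Matrix.det_apply]
  refine MvPolynomial.IsWeightedHomogeneous.sum _ _ _ fun σ _ => ?_
  rw [Units.smul_def, zsmul_eq_mul, ← zero_add (∑ k, _)]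
  refine MvPolynomial.IsWeightedHomogeneous.mul ?_ ?_
  · have := MvPolynomial.isWeightedHomogeneous_C (R := ℂ)
      (fun x : Σ i, Module.Dual ℂ (⋀[ℂ]^(d i) V) => (Pi.single x.1 1 : Fin K → ℕ))
      (((Equiv.Perm.sign σ : ℤˣ) : ℤ) : ℂ)
    simpa using this
  · exact MvPolynomial.IsWeightedHomogeneous.prod _ _ _ fun k _ =>
      MvPolynomial.isWeightedHomogeneous_X _ _ _

theorem pluckerEval_wedgeMinor {n : ℕ} (e : Module.Basis (Fin n) ℂ V)
    (r : Fin n → Fin K) (φ : Fin n → Module.Dual ℂ (ExteriorAlgebra ℂ V))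
    (W : ∀ i, Gr V (d i)) :
    pluckerEval (wedgeMinor d e r φ) W = Matrix.det (Matrix.of fun k j =>
      φ k (ExteriorAlgebra.ι ℂ (e j) *
        ((plucker V (W (r k))).rep : ExteriorAlgebra ℂ V))) := by
  unfold pluckerEval FormPoly.evalAt wedgeMinor
  rw [RingHom.map_det]
  congr 1
  ext k j
  simp [wedgeForm]

/-- That the `i`-th subspaces, `i ∈ S`, have no common nonzero vector is an open condition: it says
that `x ↦ (x ∧ w i)ᵢ` is injective, i.e. that one of its maximal minors does not vanish. -/
theorem isOpen_trivial_inter (V : Type*) [AddCommGroup V] [Module ℂ V] [FiniteDimensional ℂ V]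
    (d : Fin K → ℕ) (S : Set (Fin K)) :
    IsOpen[grassmannianZariski V d]
      {W : ∀ i, Gr V (d i) | ∀ x : V, (∀ i ∈ S, x ∈ (W i).1) → x = 0} := by
  rw [isOpen_iff_exists_pluckerEval_ne_zero]
  intro W hW
  have e := Module.finBasis ℂ V
  -- The forms `x ↦ φ (x ∧ w i)` have no common zero, so they contain a basis of the dual space.
  let ψ : Fin K → Module.Dual ℂ (ExteriorAlgebra ℂ V) → Module.Dual ℂ V := fun i φ =>
    φ ∘ₗ LinearMap.mulRight ℂ ((plucker V (W i)).rep : ExteriorAlgebra ℂ V) ∘ₗ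
      ExteriorAlgebra.ι ℂ
  let T : Set (Module.Dual ℂ V) := {g | ∃ i ∈ S, ∃ φ, g = ψ i φ}
  have hT : Submodule.span ℂ T = ⊤ := by
    have h0 : (Submodule.span ℂ T).dualCoannihilator = ⊥ := by
      rw [eq_bot_iff]
      intro x hx
      rw [Submodule.mem_dualCoannihilator] at hx
      refine hW x fun i hi => ?_
      rw [mem_iff_ι_mul_plucker_rep_eq_zero, ← Module.forall_dual_apply_eq_zero_iff ℂ]
      exact fun φ => hx _ (Submodule.subset_span ⟨i, hi, φ, rfl⟩)
    have h1 := Subspace.finrank_add_finrank_dualCoannihilator_eq (Submodule.span ℂ T)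
    rw [h0, finrank_bot, add_zero, ← Subspace.dual_finrank_eq (V := V)] at h1
    exact Submodule.eq_top_of_finrank_eq h1
  have hrank : Module.finrank ℂ (Submodule.span ℂ T) = Module.finrank ℂ V := by
    rw [hT, finrank_top, Subspace.dual_finrank_eq]
  have hbasis := Submodule.exists_fun_fin_finrank_span_eq ℂ T
  rw [hrank] at hbasis
  obtain ⟨g, hgT, hgspan, -⟩ := hbasis
  choose r hr φ hφ using hgT
  refine ⟨wedgeMinor d e r φ, ⟨_, isMultihomogeneous_wedgeMinor e r φ⟩, ?_, fun W' hW' x hx => ?_⟩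
  · rw [pluckerEval_wedgeMinor]
    intro hdet
    obtain ⟨c, hc, hMc⟩ := Matrix.exists_mulVec_eq_zero_iff.mpr hdet
    apply hc
    have hg : ∀ k, g k (∑ j, c j • e j) = 0 := fun k => by
      rw [← show _ = (0 : ℂ) from congrFun hMc k, hφ]
      simp [ψ, Matrix.mulVec, dotProduct, mul_comm (c _)]
    have hzero : ∑ j, c j • e j = 0 := by
      rw [← Module.forall_dual_apply_eq_zero_iff ℂ]
      intro f
      have hf : f ∈ Submodule.span ℂ (Set.range g) := by rw [hgspan, hT]; trivial
      induction hf using Submodule.span_induction with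
      | mem f hf => obtain ⟨k, rfl⟩ := hf; exact hg k
      | zero => rfl
      | add f f' _ _ h h' => rw [LinearMap.add_apply, h, h', add_zero]
      | smul a f _ h => rw [LinearMap.smul_apply, h, smul_zero]
    funext j
    exact Fintype.linearIndependent_iff.mp e.linearIndependent c hzero j
  · rw [pluckerEval_wedgeMinor] at hW'
    have hzero : (e.repr x : Fin _ → ℂ) = 0 := by
      refine Matrix.eq_zero_of_mulVec_eq_zero hW' (funext fun k => ?_)
      have hk := (mem_iff_ι_mul_plucker_rep_eq_zero (W' (r k)) x).mp (hx _ (hr k))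
      rw [← e.sum_repr x] at hk
      have := congrArg (φ k) hk
      simp only [map_sum, map_smul, Finset.sum_mul, smul_mul_assoc, map_zero] at this
      simpa [Matrix.mulVec, dotProduct, mul_comm] using this
    exact e.repr.map_eq_zero_iff.mp (DFunLike.coe_injective hzero)

end Zariski

/-! ### Irreducibility of products of Grassmannians -/

section Irreducible

/-- An alternating form is polynomial in `t` along a pencil `t ↦ a + t c` of families of
vectors. -/
theorem exists_polynomial_eval_eq_alternating {V : Type*} [AddCommGroup V] [Module ℂ V] {n : ℕ}
    (g : V [⋀^Fin n]→ₗ[ℂ] ℂ) (a c : Fin n → V) :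
    ∃ p : Polynomial ℂ, ∀ t, p.eval t = g (a + t • c) := by
  classical
  refine ⟨∑ s : Finset (Fin n),
    Polynomial.C (g (s.piecewise c a)) * Polynomial.X ^ s.card, fun t => ?_⟩
  have h := g.toMultilinearMap.map_add_univ (t • c) a
  rw [add_comm a]
  refine Eq.trans ?_ h.symm
  rw [Polynomial.eval_finsetSum]
  refine Finset.sum_congr rfl fun s _ => ?_
  have h' := g.toMultilinearMap.map_piecewise_smul (fun _ => t) (s.piecewise c a) s
  have h2 : s.piecewise (t • c) a
      = s.piecewise (fun i => t • s.piecewise c a i) (s.piecewise c a) := by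
    funext i
    by_cases hi : i ∈ s <;> simp [hi]
  rw [h2]
  refine Eq.trans ?_ h'.symm
  simp only [Polynomial.eval_mul, Polynomial.eval_C, Polynomial.eval_pow, Polynomial.eval_X,
    Finset.prod_const, smul_eq_mul]
  exact mul_comm _ _

variable {V : Type*} [AddCommGroup V] [Module ℂ V]
  {K : ℕ} {d : Fin K → ℕ}

theorem exists_polynomial_eval_eq_evalAt (f : FormPoly fun i => ⋀[ℂ]^(d i) V)
    (a c : ∀ i, Fin (d i) → V) :
    ∃ p : Polynomial ℂ, ∀ t, p.eval t =
      f.evalAt (fun i => exteriorPower.ιMulti ℂ (d i) (a i + t • c i)) := by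
  choose P hP using fun x : Σ i, Module.Dual ℂ (⋀[ℂ]^(d i) V) =>
    exists_polynomial_eval_eq_alternating
      (x.2.compAlternatingMap (exteriorPower.ιMulti ℂ (d x.1))) (a x.1) (c x.1)
  refine ⟨MvPolynomial.eval₂ Polynomial.C P f, fun t => ?_⟩
  rw [← Polynomial.coe_evalRingHom, MvPolynomial.hom_eval₂]
  have hC : (Polynomial.evalRingHom t).comp Polynomial.C = RingHom.id ℂ := by ext; simp
  simp only [hC, Polynomial.coe_evalRingHom, hP]
  rfl

variable [FiniteDimensional ℂ V]

/-- Nonempty open subsets of a product of Grassmannians meet: two points lie on a rational curve,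
given by the pencils spanned by bases of the subspaces, and on this curve two nonzero polynomials
in one variable have a common non-root. -/
theorem exists_pluckerEval_ne_zero_both {f g : FormPoly fun i => ⋀[ℂ]^(d i) V} {m n : Fin K → ℕ}
    (hf : f.IsMultihomogeneous m) (hg : g.IsMultihomogeneous n) {W W' : ∀ i, Gr V (d i)}
    (hW : pluckerEval f W ≠ 0) (hW' : pluckerEval g W' ≠ 0) :
    ∃ W'', pluckerEval f W'' ≠ 0 ∧ pluckerEval g W'' ≠ 0 := by
  choose a ha haspan using fun i => (W i).exists_spanning
  choose b hb hbspan using fun i => (W' i).exists_spanning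
  rw [pluckerEval_ne_zero_iff hf W ha haspan] at hW
  rw [pluckerEval_ne_zero_iff hg W' hb hbspan] at hW'
  obtain ⟨F, hF⟩ := exists_polynomial_eval_eq_evalAt f a (fun i => b i - a i)
  obtain ⟨G, hG⟩ := exists_polynomial_eval_eq_evalAt g a (fun i => b i - a i)
  choose φ hφ using fun i => not_forall.mp (mt (Module.forall_dual_apply_eq_zero_iff ℂ _).mp
    (ιMulti_ne_zero_of_linearIndependent (ha i)))
  choose Q hQ using fun i => exists_polynomial_eval_eq_alternating
    ((φ i).compAlternatingMap (exteriorPower.ιMulti ℂ (d i))) (a i) (b i - a i)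
  have hF0 : F ≠ 0 := fun h => hW (by simpa [h] using (hF 0).symm)
  have hG0 : G ≠ 0 := fun h => hW' (by simpa [h] using (hG 1).symm)
  have hQ0 : ∀ i, Q i ≠ 0 := fun i h => hφ i (by simpa [h] using (hQ i 0).symm)
  obtain ⟨t, ht⟩ : ∃ t, (F * G * ∏ i, Q i).eval t ≠ 0 := by
    by_contra! h
    exact mul_ne_zero (mul_ne_zero hF0 hG0) (Finset.prod_ne_zero_iff.mpr fun i _ => hQ0 i)
      (Polynomial.funext fun t => by rw [h t, Polynomial.eval_zero])
  rw [Polynomial.eval_mul, Polynomial.eval_mul, Polynomial.eval_prod] at ht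
  have htF := left_ne_zero_of_mul (left_ne_zero_of_mul ht)
  have htG := right_ne_zero_of_mul (left_ne_zero_of_mul ht)
  have htQ := fun i => Finset.prod_ne_zero_iff.mp (right_ne_zero_of_mul ht) i (Finset.mem_univ i)
  rw [hF] at htF
  rw [hG] at htG
  have hli : ∀ i, LinearIndependent ℂ (a i + t • (b i - a i)) := fun i => by
    apply linearIndependent_of_ιMulti_ne_zero
    intro h0
    apply htQ i
    rw [hQ, LinearMap.compAlternatingMap_apply, h0, map_zero]
  let W'' : ∀ i, Gr V (d i) := fun i =>
    ⟨Submodule.span ℂ (Set.range (a i + t • (b i - a i))), by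
      rw [finrank_span_eq_card (hli i), Fintype.card_fin]⟩
  exact ⟨W'', (pluckerEval_ne_zero_iff hf W'' hli fun _ => rfl).mpr htF,
    (pluckerEval_ne_zero_iff hg W'' hli fun _ => rfl).mpr htG⟩

theorem dense_of_isOpen_of_nonempty {U : Set (∀ i, Gr V (d i))}
    (hU : IsOpen[grassmannianZariski V d] U) (hne : U.Nonempty) :
    @Dense _ (grassmannianZariski V d) U := by
  rw [@dense_iff_inter_open _ (grassmannianZariski V d)]
  rintro U' hU' ⟨W', hW'⟩
  obtain ⟨W, hW⟩ := hne
  obtain ⟨f, ⟨m, hm⟩, hf, hfU⟩ := isOpen_iff_exists_pluckerEval_ne_zero.mp hU W hW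
  obtain ⟨g, ⟨n, hn⟩, hg, hgU⟩ := isOpen_iff_exists_pluckerEval_ne_zero.mp hU' W' hW'
  obtain ⟨W'', h1, h2⟩ := exists_pluckerEval_ne_zero_both hm hn hf hg
  exact ⟨W'', hgU _ h2, hfU _ h1⟩

end Irreducible

/-! ### The feasible variety -/

section Feasible

variable {V : Type*} [AddCommGroup V] [Module ℂ V] [FiniteDimensional ℂ V]

theorem feasibleVariety_two_eq_univ {d : ℕ} (hd : Module.finrank ℂ V = d) :
    feasibleVariety V (fun _ : Fin 2 => d) = Set.univ := by
  refine Set.eq_univ_of_forall fun W => ?_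
  have hW : ∀ i, (W i).1 = ⊤ := fun i => Submodule.eq_top_of_finrank_eq ((W i).2.trans hd.symm)
  refine ⟨fun i => (W i).2, fun i => ?_, ?_⟩
  · simp only [hW, inf_idem]
    have : Unique {j : Fin 2 // j ≠ i} := ⟨⟨⟨i.rev, by decide +revert⟩⟩, by decide +revert⟩
    exact ⟨iSupIndep_subsingleton _, by simp⟩
  · simp only [hW, inf_idem]
    have : Unique {p : Fin 2 × Fin 2 // p.1 < p.2} := ⟨⟨⟨(0, 1), by decide⟩⟩, by decide⟩
    exact ⟨iSupIndep_subsingleton _, by simp⟩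

/-- For three subspaces of dimension `2m` in dimension `3m`, trivial common intersection suffices:
each `W i ⊓ W j` has dimension at least `m`, and two of them in one `W i` are independent, so they
have dimension exactly `m` and fill `W i`. -/
theorem isFeasibleStrategy_three_iff {d : ℕ} (hd : 3 * d = 2 * Module.finrank ℂ V)
    {W : Fin 3 → Submodule ℂ V} (hW : ∀ i, Module.finrank ℂ (W i) = d) :
    IsFeasibleStrategy (fun _ => d) W ↔ ∀ x, (∀ i, x ∈ W i) → x = 0 := by
  constructor
  · intro h x hx
    have hdis := (h.decomp 0).1.pairwiseDisjoint
      (show (⟨1, by decide⟩ : {j : Fin 3 // j ≠ 0}) ≠ ⟨2, by decide⟩ by decide)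
    exact Submodule.disjoint_def.mp hdis x ⟨hx 0, hx 1⟩ ⟨hx 0, hx 2⟩
  · intro h
    have hge : ∀ i j, 2 * d ≤ Module.finrank ℂ V + Module.finrank ℂ (W i ⊓ W j : Submodule ℂ V) :=
      fun i j => by
        have h1 := Submodule.finrank_sup_add_finrank_inf_eq (W i) (W j)
        have h2 := Submodule.finrank_le (W i ⊔ W j)
        rw [hW, hW] at h1
        omega
    have hcover : ∀ i j k : Fin 3, i ≠ j → i ≠ k → j ≠ k → ∀ l, l = i ∨ l = j ∨ l = k := by
      decide
    have hdis : ∀ i j k : Fin 3, i ≠ j → i ≠ k → j ≠ k → Disjoint (W i ⊓ W j) (W i ⊓ W k) :=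
      fun i j k hij hik hjk => Submodule.disjoint_def.mpr fun x hx hx' => h x fun l => by
        rcases hcover i j k hij hik hjk l with rfl | rfl | rfl
        exacts [hx.1, hx.2, hx'.2]
    have hle : ∀ i j k : Fin 3, i ≠ j → i ≠ k → j ≠ k →
        Module.finrank ℂ (W i ⊓ W j : Submodule ℂ V)
          + Module.finrank ℂ (W i ⊓ W k : Submodule ℂ V)
        = Module.finrank ℂ (W i ⊓ W j ⊔ W i ⊓ W k : Submodule ℂ V) ∧
        Module.finrank ℂ (W i ⊓ W j ⊔ W i ⊓ W k : Submodule ℂ V) ≤ d :=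
      fun i j k hij hik hjk => by
        have h1 := Submodule.finrank_sup_add_finrank_inf_eq (W i ⊓ W j) (W i ⊓ W k)
        rw [(hdis i j k hij hik hjk).eq_bot, finrank_bot] at h1
        refine ⟨by omega, ?_⟩
        rw [← hW i]
        exact Submodule.finrank_mono (sup_le inf_le_left inf_le_left)
    have hthird : ∀ i j : Fin 3, i ≠ j → ∃ k, i ≠ k ∧ j ≠ k := by decide
    have hdim : ∀ i j : Fin 3, i ≠ j → 2 * Module.finrank ℂ (W i ⊓ W j : Submodule ℂ V) = d :=
      fun i j hij => by
        obtain ⟨k, hik, hjk⟩ := hthird i j hij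
        have := hle i j k hij hik hjk
        have := hge i j
        have := hge i k
        omega
    have hsup : ∀ i j k : Fin 3, i ≠ j → i ≠ k → j ≠ k → W i = W i ⊓ W j ⊔ W i ⊓ W k :=
      fun i j k hij hik hjk => by
        refine (Submodule.eq_of_le_of_finrank_eq (sup_le inf_le_left inf_le_left) ?_).symm
        have := (hle i j k hij hik hjk).1
        have := hdim i j hij
        have := hdim i k hik
        rw [hW]
        omega
    refine ⟨hW, fun i => isDirectSumOf_of_sum_finrank_le ?_ ?_,
      isDirectSumOf_of_sum_finrank_le ?_ ?_⟩
    · obtain ⟨j, hij⟩ := exists_ne i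
      obtain ⟨k, hik, hjk⟩ := hthird i j hij.symm
      refine le_antisymm ?_ (iSup_le fun j => inf_le_left)
      refine (hsup i j k hij.symm hik hjk).le.trans (sup_le ?_ ?_)
      · exact le_iSup (fun j : {j : Fin 3 // j ≠ i} => W i ⊓ W j.1) ⟨j, hij⟩
      · exact le_iSup (fun j : {j : Fin 3 // j ≠ i} => W i ⊓ W j.1) ⟨k, hik.symm⟩
    · have hcard : Fintype.card {j : Fin 3 // j ≠ i} = 2 := by decide +revert
      have hsum : ∑ j : {j : Fin 3 // j ≠ i},
          2 * Module.finrank ℂ (W i ⊓ W j.1 : Submodule ℂ V) = 2 * d := by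
        rw [Finset.sum_congr rfl fun j _ => hdim i j.1 j.2.symm]
        simp [hcard]
      rw [← Finset.mul_sum] at hsum
      rw [hW]
      omega
    · have hmem : ∀ i j : Fin 3, i < j →
          W i ⊓ W j ≤ ⨆ p : {p : Fin 3 × Fin 3 // p.1 < p.2}, W p.1.1 ⊓ W p.1.2 := fun i j hij =>
        le_iSup (fun p : {p : Fin 3 × Fin 3 // p.1 < p.2} => W p.1.1 ⊓ W p.1.2) ⟨(i, j), hij⟩
      -- `W 0` and `W 1 ⊓ W 2` already span: their dimensions are `d` and `d / 2`.
      have hspan : W 0 ⊔ W 1 ⊓ W 2 = ⊤ := by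
        apply Submodule.eq_top_of_finrank_eq
        have h1 := Submodule.finrank_sup_add_finrank_inf_eq (W 0) (W 1 ⊓ W 2)
        have h2 : W 0 ⊓ (W 1 ⊓ W 2) = ⊥ := by
          rw [eq_bot_iff]
          rintro x ⟨h0, h1, h2⟩
          exact h x (Fin.forall_fin_succ.mpr ⟨h0, by simpa [Fin.forall_fin_two] using ⟨h1, h2⟩⟩)
        have h3 := hdim 1 2 (by decide)
        rw [h2, finrank_bot, hW] at h1
        omega
      refine (eq_top_iff.mpr (hspan.symm.le.trans (sup_le ?_ (hmem 1 2 (by decide))))).symm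
      exact (hsup 0 1 2 (by decide) (by decide) (by decide)).le.trans
        (sup_le (hmem 0 1 (by decide)) (hmem 0 2 (by decide)))
    · have hcard : Fintype.card {p : Fin 3 × Fin 3 // p.1 < p.2} = 3 := by decide
      have hsum : ∑ p : {p : Fin 3 × Fin 3 // p.1 < p.2},
          2 * Module.finrank ℂ (W p.1.1 ⊓ W p.1.2 : Submodule ℂ V) = 3 * d := by
        rw [Finset.sum_congr rfl fun p _ => hdim p.1.1 p.1.2 p.2.ne]
        simp [hcard]
      rw [← Finset.mul_sum] at hsum
      rw [finrank_top]
      omega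

theorem isOpen_and_dense_feasibleVariety_three {d : ℕ} (hd : 3 * d = 2 * Module.finrank ℂ V)
    (hfeas : IsFeasibleTuple 3 (Module.finrank ℂ V) (fun _ => d)) :
    IsOpen[grassmannianZariski V (fun _ : Fin 3 => d)] (feasibleVariety V (fun _ : Fin 3 => d)) ∧
      @Dense _ (grassmannianZariski V (fun _ : Fin 3 => d))
        (feasibleVariety V (fun _ : Fin 3 => d)) := by
  have hset : feasibleVariety V (fun _ : Fin 3 => d)
      = {W | ∀ x : V, (∀ i ∈ (Set.univ : Set (Fin 3)), x ∈ (W i).1) → x = 0} := by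
    ext W
    refine (isFeasibleStrategy_three_iff hd fun i => (W i).2).trans ?_
    simp
  have hopen : IsOpen[grassmannianZariski V (fun _ : Fin 3 => d)]
      (feasibleVariety V (fun _ : Fin 3 => d)) := by
    rw [hset]
    exact isOpen_trivial_inter V _ _
  refine ⟨hopen, dense_of_isOpen_of_nonempty hopen ?_⟩
  obtain ⟨W, hW⟩ := hfeas
  let e : (Fin (Module.finrank ℂ V) → ℂ) ≃ₗ[ℂ] V := (Module.finBasis ℂ V).equivFun.symm
  have hfin : ∀ i, Module.finrank ℂ ((W i).map e.toLinearMap) = d := fun i => by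
    rw [← hW.finrank_eq i]
    exact LinearEquiv.finrank_map_eq e (W i)
  have hinter := (isFeasibleStrategy_three_iff (by simpa using hd) hW.finrank_eq).mp hW
  refine ⟨fun i => ⟨(W i).map e.toLinearMap, hfin i⟩,
    (isFeasibleStrategy_three_iff hd hfin).mpr fun x hx => ?_⟩
  refine e.symm.map_eq_zero_iff.mp (hinter _ fun i => ?_)
  obtain ⟨y, hy, rfl⟩ := hx i
  simpa using hy

theorem exists_disjoint_finrank_eq {d : ℕ} (hd : 2 * d ≤ Module.finrank ℂ V) :
    ∃ A B : Submodule ℂ V, Module.finrank ℂ A = d ∧ Module.finrank ℂ B = d ∧ Disjoint A B := by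
  have e := Module.finBasis ℂ V
  let a : Fin d → Fin (Module.finrank ℂ V) := fun k => ⟨k, by omega⟩
  let b : Fin d → Fin (Module.finrank ℂ V) := fun k => ⟨d + k, by omega⟩
  have ha : Function.Injective a := fun k l h => by simpa [a, Fin.ext_iff] using h
  have hb : Function.Injective b := fun k l h => by simpa [b, Fin.ext_iff] using h
  refine ⟨Submodule.span ℂ (Set.range (e ∘ a)), Submodule.span ℂ (Set.range (e ∘ b)), ?_, ?_, ?_⟩
  · rw [finrank_span_eq_card (e.linearIndependent.comp a ha), Fintype.card_fin]
  · rw [finrank_span_eq_card (e.linearIndependent.comp b hb), Fintype.card_fin]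
  · rw [Set.range_comp, Set.range_comp]
    refine e.linearIndependent.disjoint_span_image (Set.disjoint_left.mpr ?_)
    rintro _ ⟨k, rfl⟩ ⟨l, hl⟩
    simp only [a, b, Fin.mk.injEq] at hl
    omega

/-- If `0 < d` and `2 d ≤ dim V`, subspaces with `W i ⊓ W j = ⊥` for a fixed `i` and all `j ≠ i`
form a nonempty open set without feasible strategies. -/
theorem not_dense_feasibleVariety {K d : ℕ} (i : Fin K) (hd : 0 < d)
    (hdV : 2 * d ≤ Module.finrank ℂ V) :
    ¬ @Dense _ (grassmannianZariski V (fun _ : Fin K => d))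
        (feasibleVariety V (fun _ : Fin K => d)) := by
  intro hdense
  let U : Set (∀ _ : Fin K, Gr V d) :=
    ⋂ j : {j : Fin K // j ≠ i}, {W | ∀ x : V, (∀ k ∈ ({i, j.1} : Set (Fin K)), x ∈ (W k).1) → x = 0}
  have hU : IsOpen[grassmannianZariski V (fun _ : Fin K => d)] U :=
    @isOpen_iInter_of_finite _ _ (grassmannianZariski V fun _ : Fin K => d) _ _
      fun j => isOpen_trivial_inter V (fun _ : Fin K => d) _
  have hne : U.Nonempty := by
    obtain ⟨A, B, hA, hB, hAB⟩ := exists_disjoint_finrank_eq hdV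
    let A' : Gr V d := ⟨A, hA⟩
    let B' : Gr V d := ⟨B, hB⟩
    refine ⟨fun j => if j = i then A' else B', Set.mem_iInter.mpr ?_⟩
    rintro ⟨j, hj⟩ x hx
    have hxi := hx i (by simp)
    have hxj := hx j (by simp)
    beta_reduce at hxi hxj
    rw [if_pos rfl] at hxi
    rw [if_neg hj] at hxj
    exact Submodule.disjoint_def.mp hAB x hxi hxj
  obtain ⟨W, hWU, hW⟩ := (@Dense.inter_open_nonempty _ (grassmannianZariski V _) _ hdense) U hU hne
  have hbot : (W i).1 = ⊥ := by
    rw [(hW.decomp i).2, iSup_eq_bot]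
    rintro ⟨j, hj⟩
    rw [eq_bot_iff]
    rintro x ⟨hxi, hxj⟩
    exact Set.mem_iInter.mp hWU ⟨j, hj⟩ x (by simpa using ⟨hxi, hxj⟩)
  have := (W i).2
  rw [hbot, finrank_bot] at this
  omega

end Feasible

end RelayFeasibility

theorem theorem3 (K N d : ℕ) (hN : 0 < N)
    (hfeas : RelayFeasibility.IsFeasibleTuple K N (fun _ : Fin K => d))
    (V : Type*) [AddCommGroup V] [Module ℂ V] [FiniteDimensional ℂ V]
    (hV : Module.finrank ℂ V = N) :
    (IsOpen[RelayFeasibility.grassmannianZariski V (fun _ : Fin K => d)]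
        (RelayFeasibility.feasibleVariety V (fun _ : Fin K => d)) ∧
      @Dense _ (RelayFeasibility.grassmannianZariski V (fun _ : Fin K => d))
        (RelayFeasibility.feasibleVariety V (fun _ : Fin K => d))) ↔
      ((K = 2 ∧ d = N) ∨ (K = 3 ∧ (d : ℚ) = 2 * N / 3)) := by
  subst hV
  have hcount : K * d = 2 * Module.finrank ℂ V := by
    obtain ⟨W, hW⟩ := hfeas
    simpa using hW.sum_eq_two_mul_finrank
  constructor
  · rintro ⟨-, hdense⟩
    have hK : K < 4 := by
      by_contra! hK
      have hd : 0 < d := Nat.pos_of_ne_zero fun h => by simp [h] at hcount; omega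
      have hle : 4 * d ≤ K * d := Nat.mul_le_mul_right d hK
      exact RelayFeasibility.not_dense_feasibleVariety (⟨0, by omega⟩ : Fin K) hd (by omega) hdense
    interval_cases K
    · omega
    · -- A single subspace would need dimension `2 N`.
      obtain ⟨W, hW⟩ := hfeas
      have h1 := Submodule.finrank_le (W 0)
      rw [hW.finrank_eq, Module.finrank_fin_fun] at h1
      omega
    · exact Or.inl ⟨rfl, by omega⟩
    · refine Or.inr ⟨rfl, ?_⟩
      have : (3 : ℚ) * d = 2 * (Module.finrank ℂ V : ℕ) := by exact_mod_cast hcount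
      linarith
  · rintro (⟨rfl, hd⟩ | ⟨rfl, -⟩)
    · rw [RelayFeasibility.feasibleVariety_two_eq_univ hd.symm]
      exact ⟨@isOpen_univ _ (RelayFeasibility.grassmannianZariski V _),
        @dense_univ _ (RelayFeasibility.grassmannianZariski V _)⟩
    · exact RelayFeasibility.isOpen_and_dense_feasibleVariety_three hcount hfeas
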